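/- Let $n\ge 1$ and $[n]=\{1,\dots,n\}$. Exactly one element of $[n]$ is defective. A query is a set $Q\subseteq[n]$; its answer is YES if $Q$ contains the defective element and NO otherwise. Fix a family $\mathcal F\subseteq 2^{[n]}$ of queries, all asked in advance. A group $X\subseteq[n]$ knows exactly the answers to those $Q\in\mathcal F$ with $Q\cap X\neq\emptyset$. We say that $X$ finds the defective element $d$ if $d$ is the only $z\in[n]$ such that $z\in Q\Leftrightarrow d\in Q$ for every $Q\in\mathcal F$ with $Q\cap X\ne\emptyset$. For integers $1\le i<j\le n$, the family $\mathcal F$ solves Model 4 with parameters $i,j$ if - $\mathcal F$ is separating, i.e. for any two different $y,z\in[n]$ some $Q\in\mathcal F$ contains exactly one of them; - for every $d\in[n]$, every $X\subseteq[n]$ with $|X|=j$ finds the defective element $d$; - for every $d\in[n]$, no $X\subseteq[n]$ with $|X|=i$ and $d\notin X$ finds the defective element $d$. **Theorem.** Let $i=1$ and $1<j\le n$. (a) If $j\ge 4$ and $n\neq 6$, then there is a family $\mathcal F\subseteq 2^{[n]}$ that solves Model 4 with parameters $1,j$. (b) If $j=3$, $n\ne 6$, $n\not\equiv 2\pmod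 6$ and $n\not\equiv 5\pmod 6$, then there is a family $\mathcal F\subseteq 2^{[n]}$ that solves Model 4 with parameters $1,3$. -/

import Mathlib

namespace SmartElements

/-- The query family `F` is separating: any two different elements are separated by some query, so
that all answers together determine the defective element. -/
def Separating {n : ℕ} (F : Finset (Finset (Fin n))) : Prop :=
  ∀ y z : Fin n, y ≠ z → ∃ Q ∈ F, ¬ (y ∈ Q ↔ z ∈ Q)

/-- The queries whose answers are known to the group `X` when its members share their knowledge:
those containing at least one member of `X`. -/
def groupQueries {n : ℕ} (F : Finset (Finset (Fin n))) (X : Finset (Fin n)) :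
    Finset (Finset (Fin n)) :=
  F.filter fun Q => (Q ∩ X).Nonempty

/-- If `d` is the defective element, then the group `X` finds that out: every `z` that is consistent
with all the answers known to `X` equals `d`. The answer to `Q` is YES exactly if the
defective element belongs to `Q`. -/
def Finds {n : ℕ} (F : Finset (Finset (Fin n))) (X : Finset (Fin n)) (d : Fin n) : Prop :=
  ∀ z : Fin n, (∀ Q ∈ groupQueries F X, (z ∈ Q ↔ d ∈ Q)) → z = d

/-- `F` solves Model 4 with parameters `i` and `j`: `F` is separating; any `j` elements together
find the defective element, whichever it is; and no `i` elements together find it, unless it is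
one of them. -/
structure SolvesModel4 {n : ℕ} (F : Finset (Finset (Fin n))) (i j : ℕ) : Prop where
  separating : Separating F
  finds : ∀ X : Finset (Fin n), X.card = j → ∀ d : Fin n, Finds F X d
  not_finds : ∀ X : Finset (Fin n), X.card = i → ∀ d : Fin n, d ∉ X → ¬ Finds F X d

end SmartElements

namespace SmartElements

open Finset

/-! The queries are the sets `B x y` of a closure on pairs. A query through `x` that contains `y`
contains all of `B x y`, so the single element `x` fails to separate `y` from `z` exactly when `B x
y = B x z`. Model 4 with `i = 1` thus asks that every `d ≠ x` have a twin with respect to `x`, while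
any two points are twins with respect to fewer than `j` points. Taking k = 2 settles j ≥ 3, and k =
3 settles j ≥ 4.

In a Steiner triple system, with `B x y` the triple through `x` and `y`, twins are the two further
points of a triple. For other sizes two relaxations serve. Blocks of 3 or 4 points are glued with
closures on the groups of a truncated transversal design, giving sizes 3m + t
(`exists_isPairClosure_glue`, `HasPairClosure.three_mul_add`). Or some pairs lie in no triple
("gaps") and have the whole set as closure (`hasPairClosure_of_triples`); the triples x + y + z = 0
modulo an odd n are of this kind. Induction on n, with a few explicit small systems, covers all
sizes except n = 8, which gets a family of its own. -/

/-! ### Pair closures and their transport. -/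

/-- `B x y` plays the role of the smallest query containing `x` and `y`, for `x, y` in the ground set
`S`. Every point other than `x` has a twin with respect to `x`, and any two points are twins with
respect to at most `k` points. -/
structure IsPairClosure {α : Type*} [DecidableEq α] (k : ℕ) (S : Finset α)
    (B : α → α → Finset α) : Prop where
  self : ∀ x ∈ S, B x x = {x}
  symm : ∀ x ∈ S, ∀ y ∈ S, B x y = B y x
  left_mem : ∀ x ∈ S, ∀ y ∈ S, x ∈ B x y
  subset : ∀ x ∈ S, ∀ y ∈ S, B x y ⊆ S
  closed : ∀ x ∈ S, ∀ y ∈ S, ∀ u ∈ B x y, ∀ v ∈ B x y, B u v ⊆ B x y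
  twin : ∀ x ∈ S, ∀ d ∈ S, x ≠ d → ∃ z ∈ S, z ≠ d ∧ B x z = B x d
  few : ∀ y ∈ S, ∀ z ∈ S, y ≠ z → #{x ∈ S | B x y = B x z} ≤ k

namespace IsPairClosure

variable {α : Type*} [DecidableEq α] {k : ℕ} {S : Finset α} {B : α → α → Finset α}

theorem right_mem (h : IsPairClosure k S B) {x y : α} (hx : x ∈ S) (hy : y ∈ S) : y ∈ B x y :=
  h.symm x hx y hy ▸ h.left_mem y hy x hx

theorem mono (h : IsPairClosure k S B) {l : ℕ} (hkl : k ≤ l) : IsPairClosure l S B :=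
  { h with few := fun y hy z hz hyz => (h.few y hy z hz hyz).trans hkl }

/-- A pair closure can be transported to any set with the same number of elements. -/
theorem transport {β : Type*} [DecidableEq β] (h : IsPairClosure k S B) {T : Finset β}
    (hST : S.card = T.card) : ∃ C : β → β → Finset β, IsPairClosure k T C := by
  -- `a₀` and `b₀` serve only as values off the ground sets, so the empty case is separate.
  rcases T.eq_empty_or_nonempty with rfl | ⟨b₀, hb₀⟩
  · exact ⟨fun _ _ => ∅, by constructor <;> simp⟩
  obtain ⟨a₀, ha₀⟩ : S.Nonempty := by
    rw [← Finset.card_pos, hST]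
    exact Finset.card_pos.2 ⟨b₀, hb₀⟩
  let e : S ≃ T := Finset.equivOfCardEq hST
  let f : α → β := fun a => if ha : a ∈ S then e ⟨a, ha⟩ else b₀
  let g : β → α := fun b => if hb : b ∈ T then e.symm ⟨b, hb⟩ else a₀
  have hf : ∀ a ∈ S, f a ∈ T := fun a ha => by simp [f, ha]
  have hg : ∀ b ∈ T, g b ∈ S := fun b hb => by simp [g, hb]
  have hgf : ∀ a ∈ S, g (f a) = a := fun a ha => by simp [f, g, ha]
  have hfg : ∀ b ∈ T, f (g b) = b := fun b hb => by simp [f, g, hb]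
  have hinj : ∀ U ⊆ S, ∀ W ⊆ S, U.image f = W.image f → U = W := by
    have key : ∀ U ⊆ S, ∀ W ⊆ S, U.image f = W.image f → U ⊆ W := by
      intro U hU W hW hUW u hu
      have hfu : f u ∈ W.image f := hUW ▸ Finset.mem_image_of_mem f hu
      obtain ⟨w, hw, hwu⟩ := Finset.mem_image.1 hfu
      rw [← hgf u (hU hu), ← hwu, hgf w (hW hw)]
      exact hw
    exact fun U hU W hW hUW => (key U hU W hW hUW).antisymm (key W hW U hU hUW.symm)
  refine ⟨fun x y => (B (g x) (g y)).image f, ?_, ?_, ?_, ?_, ?_, ?_, ?_⟩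
  · intro x hx
    simp [h.self _ (hg x hx), hfg x hx]
  · intro x hx y hy
    rw [h.symm _ (hg x hx) _ (hg y hy)]
  · intro x hx y hy
    exact Finset.mem_image.2 ⟨g x, h.left_mem _ (hg x hx) _ (hg y hy), hfg x hx⟩
  · intro x hx y hy w hw
    obtain ⟨a, ha, rfl⟩ := Finset.mem_image.1 hw
    exact hf a (h.subset _ (hg x hx) _ (hg y hy) ha)
  · intro x hx y hy u hu v hv
    obtain ⟨a, ha, rfl⟩ := Finset.mem_image.1 hu
    obtain ⟨b, hb, rfl⟩ := Finset.mem_image.1 hv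
    have hsub := h.subset _ (hg x hx) _ (hg y hy)
    rw [hgf a (hsub ha), hgf b (hsub hb)]
    exact Finset.image_subset_image (h.closed _ (hg x hx) _ (hg y hy) a ha b hb)
  · intro x hx d hd hxd
    obtain ⟨z, hz, hzd, hB⟩ := h.twin _ (hg x hx) _ (hg d hd)
      (fun hh => hxd (by rw [← hfg x hx, hh, hfg d hd]))
    refine ⟨f z, hf z hz, fun hh => hzd (by rw [← hh, hgf z hz]), ?_⟩
    rw [hgf z hz, hB]
  · intro y hy z hz hyz
    refine le_trans ?_ (h.few _ (hg y hy) _ (hg z hz)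
      (fun hh => hyz (by rw [← hfg y hy, hh, hfg z hz])))
    refine Finset.card_le_card_of_injOn g ?_ ?_
    · intro x hx
      have hx' := Finset.mem_filter.1 (Finset.mem_coe.1 hx)
      exact Finset.mem_coe.2 (Finset.mem_filter.2 ⟨hg x hx'.1,
        hinj _ (h.subset _ (hg x hx'.1) _ (hg y hy)) _ (h.subset _ (hg x hx'.1) _ (hg z hz)) hx'.2⟩)
    · intro x hx x' hx' hxx
      have h1 := (Finset.mem_filter.1 (Finset.mem_coe.1 hx)).1
      have h2 := (Finset.mem_filter.1 (Finset.mem_coe.1 hx')).1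
      rw [← hfg x h1, hxx, hfg x' h2]

end IsPairClosure

/-- There is a pair closure on `n` points in which two points have at most `k` points with respect
to which they are twins. -/
def HasPairClosure (k n : ℕ) : Prop :=
  ∃ B : Fin n → Fin n → Finset (Fin n), IsPairClosure k univ B

theorem HasPairClosure.mono {k l n : ℕ} (h : HasPairClosure k n) (hkl : k ≤ l) :
    HasPairClosure l n :=
  h.imp fun _ hB => hB.mono hkl

theorem HasPairClosure.exists_on {k n : ℕ} (h : HasPairClosure k n) {α : Type*} [DecidableEq α]
    {S : Finset α} (hS : S.card = n) : ∃ B : α → α → Finset α, IsPairClosure k S B := by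
  obtain ⟨B, hB⟩ := h
  exact hB.transport (by simp [hS])

theorem IsPairClosure.hasPairClosure {α : Type*} [DecidableEq α] {k n : ℕ} {S : Finset α}
    {B : α → α → Finset α} (h : IsPairClosure k S B) (hS : S.card = n) : HasPairClosure k n :=
  h.transport (by simp [hS])

/-! ### From pair closures to Model 4. -/

/-- A criterion for solving Model 4 with `i = 1` in terms of the pairs not distinguished by a
single element. -/
theorem solvesModel4_of_few {n k j : ℕ} (F : Finset (Finset (Fin n))) (hkj : k < j) (hjn : j ≤ n)
    (twin : ∀ x d : Fin n, x ≠ d → ∃ z, z ≠ d ∧ ∀ Q ∈ F, x ∈ Q → (z ∈ Q ↔ d ∈ Q))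
    (few : ∀ y z : Fin n, y ≠ z → #{x : Fin n | ∀ Q ∈ F, x ∈ Q → (y ∈ Q ↔ z ∈ Q)} ≤ k) :
    SolvesModel4 F 1 j := by
  have finds : ∀ X : Finset (Fin n), X.card = j → ∀ d : Fin n, Finds F X d := by
    intro X hX d z hz
    by_contra hzd
    have hsub : X ⊆ ({x : Fin n | ∀ Q ∈ F, x ∈ Q → (z ∈ Q ↔ d ∈ Q)} : Finset (Fin n)) := by
      intro x hx
      refine Finset.mem_filter.2 ⟨Finset.mem_univ _, fun Q hQ hxQ => hz Q ?_⟩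
      exact Finset.mem_filter.2 ⟨hQ, x, Finset.mem_inter.2 ⟨hxQ, hx⟩⟩
    have := (Finset.card_le_card hsub).trans (few z d hzd)
    omega
  refine ⟨?_, finds, ?_⟩
  · intro y z hyz
    obtain ⟨X, -, hX⟩ := Finset.exists_subset_card_eq (s := (univ : Finset (Fin n)))
      (n := j) (by simpa using hjn)
    by_contra hcon
    push Not at hcon
    exact hyz (finds X hX z y fun Q hQ => hcon Q (Finset.mem_filter.1 hQ).1)
  · intro X hX d hd hfind
    obtain ⟨x, rfl⟩ := Finset.card_eq_one.1 hX
    obtain ⟨z, hzd, hz⟩ := twin x d (fun h => hd (by simp [h]))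
    refine hzd (hfind z fun Q hQ => ?_)
    obtain ⟨hQF, w, hw⟩ := Finset.mem_filter.1 hQ
    obtain ⟨hwQ, hwx⟩ := Finset.mem_inter.1 hw
    rw [Finset.mem_singleton.1 hwx] at hwQ
    exact hz Q hQF hwQ

theorem HasPairClosure.exists_solvesModel4 {k n j : ℕ} (h : HasPairClosure k n) (hkj : k < j)
    (hjn : j ≤ n) : ∃ F : Finset (Finset (Fin n)), SolvesModel4 F 1 j := by
  obtain ⟨B, hB⟩ := h
  -- A query through `x` and `a` contains `B x a`, hence also the twin `b`.
  have key : ∀ x u v a b : Fin n, B x a = B x b → x ∈ B u v → a ∈ B u v → b ∈ B u v := by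
    intro x u v a b hab hx ha
    refine hB.closed u (mem_univ _) v (mem_univ _) x hx a ha ?_
    rw [hab]
    exact hB.right_mem (mem_univ _) (mem_univ _)
  refine ⟨univ.image fun p : Fin n × Fin n => B p.1 p.2,
    solvesModel4_of_few _ hkj hjn ?_ ?_⟩
  · intro x d hxd
    obtain ⟨z, -, hzd, hz⟩ := hB.twin x (mem_univ _) d (mem_univ _) hxd
    refine ⟨z, hzd, fun Q hQ hxQ => ?_⟩
    obtain ⟨⟨u, v⟩, -, rfl⟩ := Finset.mem_image.1 hQ
    exact ⟨key x u v z d hz hxQ, key x u v d z hz.symm hxQ⟩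
  · intro y z hyz
    refine (Finset.card_le_card ?_).trans (hB.few y (mem_univ _) z (mem_univ _) hyz)
    intro x hx
    have hx := (Finset.mem_filter.1 hx).2
    refine Finset.mem_filter.2 ⟨mem_univ _, ?_⟩
    have hl : ∀ a, x ∈ B x a := fun a => hB.left_mem x (mem_univ _) a (mem_univ _)
    have hr : ∀ a, a ∈ B x a := fun a => hB.right_mem (mem_univ _) (mem_univ _)
    have hm : ∀ a, B x a ∈ univ.image fun p : Fin n × Fin n => B p.1 p.2 := fun a =>
      Finset.mem_image.2 ⟨(x, a), mem_univ _, rfl⟩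
    -- Conversely, the two queries `B x z` and `B x y` already detect that `y` and `z` are not
    -- twins.
    exact (hB.closed x (mem_univ _) z (mem_univ _) x (hl z) y
        ((hx _ (hm z) (hl z)).2 (hr z))).antisymm
      (hB.closed x (mem_univ _) y (mem_univ _) x (hl y) z
        ((hx _ (hm y) (hl y)).1 (hr y)))

/-! ### Gluing along lines. -/

/-- Gluing: if the points outside a common group are joined by unique lines, each of which meets
every group at most once, then pair closures on the groups extend to the whole set. -/
theorem exists_isPairClosure_glue {α ι Λ : Type*} [DecidableEq α] [DecidableEq ι] {k : ℕ}
    (V : Finset α) (g : α → ι) (I : α → Λ → Prop)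
    (hex : ∀ x ∈ V, ∀ y ∈ V, g x ≠ g y → ∃ l, I x l ∧ I y l)
    (huniq : ∀ x ∈ V, ∀ y ∈ V, g x ≠ g y → ∀ l l', I x l → I y l → I x l' → I y l' → l = l')
    (hpart : ∀ x ∈ V, ∀ y ∈ V, ∀ l, I x l → I y l → g x = g y → x = y)
    (hcard : ∀ l, ∃ U : Finset α, (∀ p, p ∈ U ↔ p ∈ V ∧ I p l) ∧ 3 ≤ U.card ∧ U.card ≤ k + 2)
    (hgroup : ∀ i, ∃ B, IsPairClosure k {x ∈ V | g x = i} B) :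
    ∃ B, IsPairClosure k V B := by
  classical
  choose U hU hU3 hUk using hcard
  choose C hC using hgroup
  have hmg : ∀ {x i}, x ∈ ({x ∈ V | g x = i} : Finset α) ↔ x ∈ V ∧ g x = i := Finset.mem_filter
  let B : α → α → Finset α := fun x y =>
    if g x = g y then C (g x) x y else if h : ∃ l, I x l ∧ I y l then U h.choose else ∅
  have hBg : ∀ x y, g x = g y → B x y = C (g x) x y := fun x y h => if_pos h
  have hBl : ∀ x ∈ V, ∀ y ∈ V, g x ≠ g y → ∀ l, I x l → I y l → B x y = U l := by
    intro x hx y hy hxy l hxl hyl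
    have h : ∃ l, I x l ∧ I y l := ⟨l, hxl, hyl⟩
    have e : B x y = U h.choose := by
      simp only [B]
      rw [if_neg hxy, dif_pos h]
    rw [e, huniq x hx y hy hxy _ _ h.choose_spec.1 h.choose_spec.2 hxl hyl]
  have hself : ∀ x ∈ V, B x x = {x} := fun x hx =>
    (hBg x x rfl).trans ((hC (g x)).self x (hmg.2 ⟨hx, rfl⟩))
  have hsymm : ∀ x ∈ V, ∀ y ∈ V, B x y = B y x := by
    intro x hx y hy
    by_cases hxy : g x = g y
    · rw [hBg x y hxy, hBg y x hxy.symm, ← hxy]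
      exact (hC (g x)).symm x (hmg.2 ⟨hx, rfl⟩) y (hmg.2 ⟨hy, hxy.symm⟩)
    · obtain ⟨l, hxl, hyl⟩ := hex x hx y hy hxy
      rw [hBl x hx y hy hxy l hxl hyl, hBl y hy x hx (Ne.symm hxy) l hyl hxl]
  have hleft : ∀ x ∈ V, ∀ y ∈ V, x ∈ B x y := by
    intro x hx y hy
    by_cases hxy : g x = g y
    · rw [hBg x y hxy]
      exact (hC (g x)).left_mem x (hmg.2 ⟨hx, rfl⟩) y (hmg.2 ⟨hy, hxy.symm⟩)
    · obtain ⟨l, hxl, hyl⟩ := hex x hx y hy hxy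
      rw [hBl x hx y hy hxy l hxl hyl, hU]
      exact ⟨hx, hxl⟩
  have hright : ∀ x ∈ V, ∀ y ∈ V, y ∈ B x y := fun x hx y hy =>
    hsymm x hx y hy ▸ hleft y hy x hx
  have hsubg : ∀ x ∈ V, ∀ y ∈ V, g x = g y → ∀ w ∈ B x y, w ∈ V ∧ g w = g x := by
    intro x hx y hy hxy w hw
    rw [hBg x y hxy] at hw
    exact hmg.1 ((hC (g x)).subset x (hmg.2 ⟨hx, rfl⟩) y (hmg.2 ⟨hy, hxy.symm⟩) hw)
  refine ⟨B, hself, hsymm, hleft, ?_, ?_, ?_, ?_⟩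
  · intro x hx y hy w hw
    by_cases hxy : g x = g y
    · exact (hsubg x hx y hy hxy w hw).1
    · obtain ⟨l, hxl, hyl⟩ := hex x hx y hy hxy
      rw [hBl x hx y hy hxy l hxl hyl, hU] at hw
      exact hw.1
  · intro x hx y hy u hu v hv
    by_cases hxy : g x = g y
    · have hu' := hsubg x hx y hy hxy u hu
      have hv' := hsubg x hx y hy hxy v hv
      rw [hBg x y hxy] at hu hv ⊢
      rw [hBg u v (hu'.2.trans hv'.2.symm), hu'.2]
      exact (hC (g x)).closed x (hmg.2 ⟨hx, rfl⟩) y (hmg.2 ⟨hy, hxy.symm⟩) u hu v hv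
    · obtain ⟨l, hxl, hyl⟩ := hex x hx y hy hxy
      rw [hBl x hx y hy hxy l hxl hyl] at hu hv ⊢
      have hu' := (hU l u).1 hu
      have hv' := (hU l v).1 hv
      by_cases huv : g u = g v
      · obtain rfl := hpart u hu'.1 v hv'.1 l hu'.2 hv'.2 huv
        rw [hself u hu'.1]
        exact Finset.singleton_subset_iff.2 hu
      · rw [hBl u hu'.1 v hv'.1 huv l hu'.2 hv'.2]
  · intro x hx d hd hxd
    by_cases hg : g x = g d
    · obtain ⟨z, hz, hzd, hB⟩ := (hC (g x)).twin x (hmg.2 ⟨hx, rfl⟩) d (hmg.2 ⟨hd, hg.symm⟩) hxd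
      have hz' := hmg.1 hz
      exact ⟨z, hz'.1, hzd, by rw [hBg x z hz'.2.symm, hBg x d hg, hB]⟩
    · obtain ⟨l, hxl, hdl⟩ := hex x hx d hd hg
      have hlt : ({x, d} : Finset α).card < (U l).card :=
        lt_of_le_of_lt Finset.card_le_two (hU3 l)
      obtain ⟨z, hzU, hz⟩ := Finset.exists_mem_notMem_of_card_lt_card hlt
      simp only [Finset.mem_insert, Finset.mem_singleton, not_or] at hz
      have hz' := (hU l z).1 hzU
      have hgz : g x ≠ g z := fun h => hz.1 (hpart x hx z hz'.1 l hxl hz'.2 h).symm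
      exact ⟨z, hz'.1, hz.2, by rw [hBl x hx z hz'.1 hgz l hxl hz'.2, hBl x hx d hd hg l hxl hdl]⟩
  · intro y hy z hz hyz
    -- For `y`, `z` in one group, `x` must lie there too, since a line meets the group only once.
    -- Otherwise `x` is one of the at most `k` further points of the line through `y` and `z`.
    by_cases hg : g y = g z
    · refine (Finset.card_le_card ?_).trans
        ((hC (g y)).few y (hmg.2 ⟨hy, rfl⟩) z (hmg.2 ⟨hz, hg.symm⟩) hyz)
      intro x hx
      obtain ⟨hxV, hB⟩ := Finset.mem_filter.1 hx
      by_cases hxy : g x = g y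
      · refine Finset.mem_filter.2 ⟨hmg.2 ⟨hxV, hxy⟩, ?_⟩
        rw [← hxy, ← hBg x y hxy, ← hBg x z (hxy.trans hg), hB]
      · obtain ⟨l, hxl, hyl⟩ := hex x hxV y hy hxy
        have hzl : z ∈ B x y := hB ▸ hright x hxV z hz
        rw [hBl x hxV y hy hxy l hxl hyl, hU] at hzl
        exact absurd (hpart y hy z hz l hyl hzl.2 hg) hyz
    · obtain ⟨l, hyl, hzl⟩ := hex y hy z hz hg
      have hcard : (((U l).erase y).erase z).card ≤ k := by
        rw [Finset.card_erase_of_mem (Finset.mem_erase.2 ⟨hyz.symm, (hU l z).2 ⟨hz, hzl⟩⟩),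
          Finset.card_erase_of_mem ((hU l y).2 ⟨hy, hyl⟩)]
        have := hUk l
        omega
      refine (Finset.card_le_card ?_).trans hcard
      intro x hx
      obtain ⟨hxV, hB⟩ := Finset.mem_filter.1 hx
      have hxy : g x ≠ g y := fun h =>
        hg (((hsubg x hxV y hy h z (hB ▸ hright x hxV z hz)).2.trans h).symm)
      have hxz : g x ≠ g z := fun h =>
        hg ((hsubg x hxV z hz h y (hB ▸ hright x hxV y hy)).2.trans h)
      obtain ⟨l', hxl, hyl'⟩ := hex x hxV y hy hxy
      have hzl' : z ∈ B x y := hB ▸ hright x hxV z hz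
      rw [hBl x hxV y hy hxy l' hxl hyl', hU] at hzl'
      obtain rfl := huniq y hy z hz hg l l' hyl hzl hyl' hzl'.2
      exact Finset.mem_erase.2 ⟨fun h => hxz (by rw [h]), Finset.mem_erase.2
        ⟨fun h => hxy (by rw [h]), (hU l x).2 ⟨hxV, hxl⟩⟩⟩

/-! ### Transversal designs of odd order with four groups. -/

theorem ZMod.exists_half {n : ℕ} (hn : Odd n) : ∃ h : ZMod n, 2 * h = 1 := by
  obtain ⟨r, rfl⟩ := hn
  refine ⟨r + 1, ?_⟩
  have : ((2 * r + 1 : ℕ) : ZMod (2 * r + 1)) = 0 := ZMod.natCast_self _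
  push_cast at this
  linear_combination this

theorem ZMod.card_val_lt {m t : ℕ} [NeZero m] (htm : t ≤ m) :
    #{x : ZMod m | x.val < t} = t := by
  rw [← Finset.card_range t]
  refine Finset.card_bij (fun x _ => x.val) (by simp) (fun x _ y _ h => ZMod.val_injective m h) ?_
  intro b hb
  have hb := Finset.mem_range.1 hb
  refine ⟨(b : ZMod m), ?_, ?_⟩ <;> simp [ZMod.val_natCast_of_lt (hb.trans_le htm), hb]

/-- The point in which the line with parameters `l` of the transversal design meets group `i`. -/
def transversalPoint {R : Type*} [CommRing R] (l : R × R) (i : Fin 4) : R :=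
  ![l.1, l.2, l.1 + l.2, l.1 - l.2] i

/-- Any two of the forms a, b, a + b, a - b have determinant ±1 or ±2, a unit once 2 is invertible.
-/
theorem transversalPoint_unique {R : Type*} [CommRing R] {h : R} (hh : 2 * h = 1) {i j : Fin 4}
    (hij : i ≠ j) {l l' : R × R} (hi : transversalPoint l i = transversalPoint l' i)
    (hj : transversalPoint l j = transversalPoint l' j) : l = l' := by
  obtain ⟨a, b⟩ := l
  obtain ⟨a', b'⟩ := l'
  have cancel : ∀ u v : R, 2 * u = 2 * v → u = v := fun u v huv => by
    linear_combination h * huv - (u - v) * hh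
  have ha := cancel a a'
  have hb := cancel b b'
  fin_cases i <;> fin_cases j <;> simp [transversalPoint] at hij hi hj ⊢ <;> grind

theorem transversalPoint_exists {R : Type*} [CommRing R] {h : R} (hh : 2 * h = 1) {i j : Fin 4}
    (hij : i ≠ j) (x y : R) : ∃ l, transversalPoint l i = x ∧ transversalPoint l j = y := by
  have hx : h * (x + y) + h * (x - y) = x := by linear_combination x * hh
  have hy : h * (x + y) - h * (x - y) = y := by linear_combination y * hh
  have hx' : h * (x + y) - h * (y - x) = x := by linear_combination x * hh
  have hy' : h * (x + y) + h * (y - x) = y := by linear_combination y * hh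
  fin_cases i <;> fin_cases j <;> first | exact absurd rfl hij | skip
  · exact ⟨(x, y), rfl, rfl⟩
  · exact ⟨(x, y - x), rfl, add_sub_cancel x y⟩
  · exact ⟨(x, x - y), rfl, sub_sub_cancel x y⟩
  · exact ⟨(y, x), rfl, rfl⟩
  · exact ⟨(y - x, x), rfl, sub_add_cancel y x⟩
  · exact ⟨(y + x, x), rfl, add_sub_cancel_right y x⟩
  · exact ⟨(y, x - y), add_sub_cancel y x, rfl⟩
  · exact ⟨(x - y, y), sub_add_cancel x y, rfl⟩
  · exact ⟨(h * (x + y), h * (x - y)), hx, hy⟩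
  · exact ⟨(y, y - x), sub_sub_cancel y x, rfl⟩
  · exact ⟨(x + y, y), add_sub_cancel_right x y, rfl⟩
  · exact ⟨(h * (x + y), h * (y - x)), hx', hy'⟩

/-- Truncating one group of a transversal design with four groups of odd size `m`. -/
theorem HasPairClosure.three_mul_add {k m t : ℕ} (hk : 2 ≤ k) (hm : Odd m) (htm : t ≤ m)
    (h : HasPairClosure k m) (h' : HasPairClosure k t) : HasPairClosure k (3 * m + t) := by
  have : NeZero m := ⟨hm.pos.ne'⟩
  obtain ⟨c, hc⟩ := ZMod.exists_half hm
  let V : Finset (ZMod m × Fin 4) := {p | p.2 = 3 → p.1.val < t}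
  have hmV : ∀ p, p ∈ V ↔ (p.2 = 3 → p.1.val < t) := fun p => by simp [V]
  have hfib : ∀ i : Fin 4, #{x ∈ V | x.2 = i} = if i = 3 then t else m := by
    intro i
    have himg : ({x ∈ V | x.2 = i} : Finset _) =
        ({x : ZMod m | i = 3 → x.val < t} : Finset _).image fun x => (x, i) := by
      ext ⟨x, j⟩
      simp only [Finset.mem_filter, hmV, Finset.mem_image, Finset.mem_univ, true_and,
        Prod.mk.injEq]
      constructor
      · rintro ⟨h1, rfl⟩
        exact ⟨x, h1, rfl, rfl⟩
      · rintro ⟨x', h1, rfl, rfl⟩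
        exact ⟨h1, rfl⟩
    rw [himg, Finset.card_image_of_injective _ (fun x y h => (Prod.mk.inj h).1)]
    split_ifs with hi
    · simpa [hi] using ZMod.card_val_lt htm
    · simp [hi, ZMod.card]
  obtain ⟨B, hB⟩ := exists_isPairClosure_glue (k := k) V (fun p => p.2)
    (fun p (l : ZMod m × ZMod m) => transversalPoint l p.2 = p.1)
    (fun x _ y _ hxy => transversalPoint_exists hc hxy x.1 y.1)
    (fun x _ y _ hxy l l' h1 h2 h3 h4 =>
      transversalPoint_unique hc hxy (h1.trans h3.symm) (h2.trans h4.symm))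
    (fun x _ y _ l h1 h2 h3 => Prod.ext (by rw [← h1, ← h2, h3]) h3)
    (fun l => by
      have hinj : Function.Injective fun i : Fin 4 => (transversalPoint l i, i) :=
        fun i j h => (Prod.mk.inj h).2
      refine ⟨{p ∈ univ.image fun i : Fin 4 => (transversalPoint l i, i) | p ∈ V}, ?_, ?_, ?_⟩
      · rintro ⟨x, i⟩
        simp only [Finset.mem_filter, Finset.mem_image, Finset.mem_univ, true_and, Prod.mk.injEq]
        constructor
        · rintro ⟨⟨j, rfl, rfl⟩, h⟩
          exact ⟨h, rfl⟩
        · rintro ⟨h, rfl⟩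
          exact ⟨⟨i, rfl, rfl⟩, h⟩
      -- Truncation affects only group 3, so each line keeps its points in the other three groups.
      · have hsub : ({0, 1, 2} : Finset (Fin 4)).image (fun i => (transversalPoint l i, i)) ⊆
            {p ∈ univ.image fun i : Fin 4 => (transversalPoint l i, i) | p ∈ V} := by
          intro p hp
          obtain ⟨i, hi, rfl⟩ := Finset.mem_image.1 hp
          refine Finset.mem_filter.2 ⟨Finset.mem_image_of_mem _ (mem_univ i), (hmV _).2 ?_⟩
          rintro rfl
          simp at hi
        refine le_trans ?_ (Finset.card_le_card hsub)
        rw [Finset.card_image_of_injective _ hinj]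
        decide
      · refine (Finset.card_filter_le _ _).trans (Finset.card_image_le.trans ?_)
        simp only [Finset.card_univ, Fintype.card_fin]
        omega)
    (fun i => by
      have hi := hfib i
      split_ifs at hi
      · exact h'.exists_on hi
      · exact h.exists_on hi)
  refine hB.hasPairClosure ?_
  rw [Finset.card_eq_sum_card_fiberwise (f := fun p : ZMod m × Fin 4 => p.2) (t := univ)
    (fun _ _ => Finset.mem_coe.2 (mem_univ _))]
  simp only [hfib, Fin.sum_univ_four]
  simp
  ring

/-! ### Trivial sizes and partial triple systems. -/

theorem hasPairClosure_zero (k : ℕ) : HasPairClosure k 0 :=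
  ⟨fun _ _ => ∅, by constructor <;> simp⟩

theorem hasPairClosure_one (k : ℕ) : HasPairClosure k 1 :=
  ⟨fun x _ => {x}, by constructor <;> simp [Subsingleton.elim _ (0 : Fin 1)]⟩

/-- A pair closure from a partial triple system. The third point of the triple through distinct
points `x, y` is `f x y`; if there is no such triple then `f x y` is `x` or `y`, and the closure of
`x, y` is everything. -/
theorem hasPairClosure_of_triples {α : Type*} [Fintype α] [DecidableEq α] {k n : ℕ}
    (f : α → α → α) (hα : Fintype.card α = n) (hn : 4 ≤ n)
    (hsymm : ∀ x y, x ≠ y → (f x y = x ∨ f x y = y) → f y x = y ∨ f y x = x)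
    (htriple : ∀ x y, x ≠ y → ¬ (f x y = x ∨ f x y = y) →
      f y x = f x y ∧ f x (f x y) = y ∧ x ≠ f x y)
    (htwin : ∀ x d, x ≠ d → (f x d = x ∨ f x d = d) →
      ∃ z, z ≠ x ∧ z ≠ d ∧ (f x z = x ∨ f x z = z))
    (hfew : ∀ y z, y ≠ z →
      #{x | x ≠ y ∧ x ≠ z ∧ (f x y = x ∨ f x y = y) ∧ (f x z = x ∨ f x z = z)} +
        (if f y z = y ∨ f y z = z then 0 else 1) ≤ k) :
    HasPairClosure k n := by
  let G : α → α → Prop := fun x y => f x y = x ∨ f x y = y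
  let B : α → α → Finset α := fun x y =>
    if x = y then {x} else if f x y = x ∨ f x y = y then univ else {x, y, f x y}
  have hBs : ∀ x, B x x = {x} := fun x => if_pos rfl
  have hBu : ∀ x y, x ≠ y → G x y → B x y = univ := fun x y h h' => by
    simp only [B]
    rw [if_neg h, if_pos h']
  have hBt : ∀ x y, x ≠ y → ¬ G x y → B x y = {x, y, f x y} := fun x y h h' => by
    simp only [B]
    rw [if_neg h, if_neg h']
  have hGs : ∀ x y, x ≠ y → G x y → G y x := hsymm
  have hth : ∀ x y, x ≠ y → ¬ G x y → ¬ G x (f x y) := by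
    rintro x y hxy h (h' | h') <;> rw [(htriple x y hxy h).2.1] at h'
    · exact hxy h'.symm
    · exact h (Or.inr h'.symm)
  have hBth : ∀ x y, x ≠ y → ¬ G x y → B x (f x y) = B x y := by
    intro x y hxy h
    rw [hBt x _ (htriple x y hxy h).2.2 (hth x y hxy h), hBt x y hxy h, (htriple x y hxy h).2.1]
    ext w
    simp only [Finset.mem_insert, Finset.mem_singleton]
    tauto
  have hsB : ∀ x y, B x y = B y x := by
    intro x y
    rcases eq_or_ne x y with rfl | hxy
    · rfl
    by_cases h : G x y
    · rw [hBu x y hxy h, hBu y x hxy.symm (hGs x y hxy h)]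
    · rw [hBt x y hxy h, hBt y x hxy.symm (fun h' => h (hGs y x hxy.symm h')),
        (htriple x y hxy h).1]
      exact Finset.insert_comm x y _
  have hleft : ∀ x y, x ∈ B x y := by
    intro x y
    simp only [B]
    split_ifs <;> simp
  have hright : ∀ x y, y ∈ B x y := fun x y => hsB x y ▸ hleft y x
  -- With at least 4 points, the closure of a gap is never a triple.
  have hcard : ∀ a b c : α, ({a, b, c} : Finset α) ≠ univ := by
    intro a b c h
    have h3 : ({a, b, c} : Finset α).card ≤ 3 := Finset.card_le_three
    rw [h, Finset.card_univ] at h3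
    omega
  refine IsPairClosure.hasPairClosure (S := univ) (B := B) ⟨fun x _ => hBs x, fun x _ y _ => hsB x y,
    fun x _ y _ => hleft x y, fun x _ y _ => Finset.subset_univ _, ?_, ?_, ?_⟩
    (by rw [Finset.card_univ, hα])
  · intro x _ y _ u hu v hv
    rcases eq_or_ne x y with rfl | hxy
    · rw [hBs, Finset.mem_singleton] at hu hv
      rw [hu, hv]
    by_cases h : G x y
    · rw [hBu x y hxy h]
      exact Finset.subset_univ _
    have h' : ¬ G y x := fun h' => h (hGs y x hxy.symm h')
    rcases eq_or_ne u v with rfl | huv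
    · rw [hBs]
      exact Finset.singleton_subset_iff.2 hu
    have hyt : B y (f x y) = B x y := by
      rw [← (htriple x y hxy h).1, hBth y x hxy.symm h', hsB]
    have hxt := hBth x y hxy h
    have hu' := hu
    have hv' := hv
    rw [hBt x y hxy h] at hu' hv'
    simp only [Finset.mem_insert, Finset.mem_singleton] at hu' hv'
    rcases hu' with rfl | rfl | rfl <;> rcases hv' with rfl | rfl | rfl
    · exact absurd rfl huv
    · exact subset_rfl
    · exact hxt.subset
    · exact (hsB _ _).subset
    · exact absurd rfl huv
    · exact hyt.subset
    · exact ((hsB _ _).trans hxt).subset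
    · exact ((hsB _ _).trans hyt).subset
    · exact absurd rfl huv
  · intro x _ d _ hxd
    by_cases h : G x d
    · obtain ⟨z, hzx, hzd, hz⟩ := htwin x d hxd h
      exact ⟨z, mem_univ _, hzd, by rw [hBu x z hzx.symm hz, hBu x d hxd h]⟩
    · exact ⟨f x d, mem_univ _, fun h' => h (Or.inr h'), hBth x d hxd h⟩
  · intro y _ z _ hyz
    refine le_trans ?_ (hfew y z hyz)
    have hne : ∀ x, B x y = B x z → x ≠ y ∧ x ≠ z := by
      intro x hx
      constructor
      · rintro rfl
        have := hright x z
        rw [← hx, hBs, Finset.mem_singleton] at this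
        exact hyz this.symm
      · rintro rfl
        have := hright x y
        rw [hx, hBs, Finset.mem_singleton] at this
        exact hyz this
    -- Either both pairs are gaps, or `x` completes the triple of `y` and `z`; these are the two
    -- summands of `hfew`.
    have hcases : ∀ x, B x y = B x z → G x y ∧ G x z ∨ ¬ G y z ∧ x = f y z := by
      intro x hx
      obtain ⟨hxy, hxz⟩ := hne x hx
      by_cases h1 : G x y <;> by_cases h2 : G x z
      · exact Or.inl ⟨h1, h2⟩
      · rw [hBu x y hxy h1, hBt x z hxz h2] at hx
        exact absurd hx.symm (hcard _ _ _)
      · rw [hBu x z hxz h2, hBt x y hxy h1] at hx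
        exact absurd hx (hcard _ _ _)
      · have hz := hright x z
        rw [← hx, hBt x y hxy h1] at hz
        simp only [Finset.mem_insert, Finset.mem_singleton] at hz
        have hz : z = f y x := by
          rcases hz with h | h | h
          · exact absurd h.symm hxz
          · exact absurd h.symm hyz
          · rw [h, (htriple x y hxy h1).1]
        have h1' : ¬ G y x := fun h' => h1 (hGs y x hxy.symm h')
        subst hz
        exact Or.inr ⟨hth y x hxy.symm h1', (htriple y x hxy.symm h1').2.1.symm⟩
    have hsub : ({x ∈ univ | B x y = B x z} : Finset α) ⊆
        ({x | x ≠ y ∧ x ≠ z ∧ (f x y = x ∨ f x y = y) ∧ (f x z = x ∨ f x z = z)} : Finset α) ∪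
          (if f y z = y ∨ f y z = z then ∅ else {f y z}) := by
      intro x hx
      have hx := (Finset.mem_filter.1 hx).2
      rw [Finset.mem_union]
      rcases hcases x hx with ⟨h1, h2⟩ | ⟨h1, h2⟩
      · exact Or.inl (Finset.mem_filter.2 ⟨mem_univ _, (hne x hx).1, (hne x hx).2, h1, h2⟩)
      · right
        rw [if_neg h1]
        exact Finset.mem_singleton.2 h2
    refine (Finset.card_le_card hsub).trans ((Finset.card_union_le _ _).trans ?_)
    gcongr
    split_ifs <;> simp

/-- The triples `{x, y, z}` of integers modulo `n` with `x + y + z = 0`. -/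
theorem hasPairClosure_of_zmod {k n : ℕ} [NeZero n] (hodd : Odd n) (hn : 4 ≤ n)
    (hfew : ∀ y z : ZMod n, y ≠ z →
      #{x : ZMod n | x ≠ y ∧ x ≠ z ∧ (-x - y = x ∨ -x - y = y) ∧ (-x - z = x ∨ -x - z = z)} +
        (if -y - z = y ∨ -y - z = z then 0 else 1) ≤ k) :
    HasPairClosure k n := by
  obtain ⟨h, hh⟩ := ZMod.exists_half hodd
  refine hasPairClosure_of_triples (fun x y : ZMod n => -x - y) (ZMod.card n) hn ?_ ?_ ?_ hfew
  · rintro x y hxy (h1 | h1)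
    · right
      linear_combination h1
    · left
      linear_combination h1
  · intro x y hxy h1
    refine ⟨by ring, by ring, fun h2 => h1 (Or.inl h2.symm)⟩
  -- The gaps at `x` are its pairs with -2x and -x/2; each of these is a twin of the other.
  · rintro x d hxd (h1 | h1)
    · refine ⟨-h * x, fun h2 => hxd ?_, fun h2 => hxd ?_, Or.inr ?_⟩
      · linear_combination h1 - 2 * h2 - x * hh
      · linear_combination 2 * h2 - h1 + x * hh
      · linear_combination x * hh
    · refine ⟨-2 * x, fun h2 => hxd ?_, fun h2 => hxd ?_, Or.inl ?_⟩
      · linear_combination -h1 - h * (h2 - 3 * h1) + 3 * d * hh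
      · linear_combination h1 - h2
      · ring

/-- Two gap neighbours of `y`, plus possibly the third point of a triple, give the bound 3. -/
theorem hasPairClosure_three_of_odd {n : ℕ} (hodd : Odd n) (hn : 4 ≤ n) :
    HasPairClosure 3 n := by
  have : NeZero n := ⟨by omega⟩
  obtain ⟨h, hh⟩ := ZMod.exists_half hodd
  refine hasPairClosure_of_zmod hodd hn fun y z hyz => ?_
  have hsub : ({x : ZMod n | x ≠ y ∧ x ≠ z ∧ (-x - y = x ∨ -x - y = y) ∧
      (-x - z = x ∨ -x - z = z)} : Finset (ZMod n)) ⊆ {-h * y, -2 * y} := by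
    intro x hx
    obtain ⟨-, -, -, h1 | h1, -⟩ := Finset.mem_filter.1 hx <;>
      simp only [Finset.mem_insert, Finset.mem_singleton]
    · left
      grind
    · right
      grind
  have h2 := (Finset.card_le_card hsub).trans Finset.card_le_two
  split_ifs <;> omega

/-- Two common gap neighbours would form a 4-cycle of multiplication by -2, so 15b = 0. As 5 is a
unit, 3b = 0, and then -2b = b collapses the cycle. -/
theorem hasPairClosure_two_of_coprime {n : ℕ} (hodd : Odd n) (hn : 4 ≤ n)
    (h5 : Nat.Coprime 5 n) : HasPairClosure 2 n := by
  have : NeZero n := ⟨by omega⟩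
  obtain ⟨h, hh⟩ := ZMod.exists_half hodd
  obtain ⟨c, hc⟩ : ∃ c : ZMod n, 5 * c = 1 :=
    ⟨_, by simpa using ZMod.coe_mul_inv_eq_one 5 h5⟩
  refine hasPairClosure_of_zmod hodd hn fun y z hyz => ?_
  have hone : #{x : ZMod n | x ≠ y ∧ x ≠ z ∧ (-x - y = x ∨ -x - y = y) ∧
      (-x - z = x ∨ -x - z = z)} ≤ 1 := by
    refine Finset.card_le_one.2 fun a ha b hb => ?_
    obtain ⟨-, hay, haz, h1, h2⟩ := Finset.mem_filter.1 ha
    obtain ⟨-, hby, hbz, h3, h4⟩ := Finset.mem_filter.1 hb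
    have hb15 : 15 * b = 0 → 3 * b = 0 := fun h15 => by
      linear_combination c * h15 - 3 * b * hc
    have key : ∀ u v : ZMod n, -a - u = a → -a - v = v → -b - u = u → -b - v = b → a = b := by
      intro u v e1 e2 e3 e4
      have h3b := hb15 (by linear_combination e3 - 2 * e1 + 4 * e2 - 8 * e4)
      linear_combination h3b - e2 + 2 * e4
    clear ha hb hb15
    rcases h1 with h1 | h1 <;> rcases h2 with h2 | h2
    · exact absurd (by linear_combination h2 - h1) hyz
    · rcases h3 with h3 | h3 <;> rcases h4 with h4 | h4
      · exact absurd (by linear_combination h4 - h3) hyz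
      · grind
      · exact key y z h1 h2 h3 h4
      · grind
    · rcases h3 with h3 | h3 <;> rcases h4 with h4 | h4
      · exact absurd (by linear_combination h4 - h3) hyz
      · exact key z y h2 h1 h4 h3
      · grind
      · grind
    · grind
  split_ifs <;> omega

/-! ### Explicit small systems. -/

/-- The operation on `2 * q` points, two copies of the integers modulo `q`, that is invariant under
translation and has the given rows at the two zeros. -/
def cyclicOp (q : ℕ) (r : Fin 2 → List ℕ) (n : ℕ) [NeZero n] (x y : Fin n) : Fin n :=
  let v := (r (Fin.ofNat 2 (x / q))).getD ((y + q - x % q) % q + q * (y / q)) 0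
  Fin.ofNat n ((v + x) % q + q * (v / q))

theorem hasPairClosure_two_fifteen : HasPairClosure 2 15 :=
  -- The lines of the projective space PG(3, 2): point `x` stands for the nonzero binary vector `x +
  -- 1`, and there are no gaps.
  hasPairClosure_of_triples
    (fun x y : Fin 15 => Fin.ofNat 15 (Nat.xor (x + 1) (y + 1) - 1)) rfl (by decide)
    (by decide +kernel) (by decide +kernel) (by decide +kernel) (by decide +kernel)

theorem hasPairClosure_two_sixteen : HasPairClosure 2 16 :=
  -- An entry equal to its base point, 0 in the first row and `q` in the second, marks a gap;
  -- likewise in the next two tables.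
  hasPairClosure_of_triples
    (cyclicOp 8 ![[0, 9, 0, 10, 0, 15, 0, 8, 7, 1, 3, 14, 13, 12, 11, 5],
      [7, 6, 13, 15, 9, 11, 1, 0, 8, 4, 8, 5, 8, 2, 8, 3]] 16) rfl (by decide)
    (by decide +kernel) (by decide +kernel) (by decide +kernel) (by decide +kernel)

theorem hasPairClosure_two_eighteen : HasPairClosure 2 18 :=
  hasPairClosure_of_triples
    (cyclicOp 9 ![[0, 0, 9, 6, 10, 15, 3, 16, 0, 2, 4, 0, 0, 14, 13, 5, 7, 0],
      [2, 9, 0, 8, 17, 10, 9, 9, 3, 9, 5, 14, 16, 15, 11, 13, 12, 4]] 18) rfl (by decide)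
    (by decide +kernel) (by decide +kernel) (by decide +kernel) (by decide +kernel)

theorem hasPairClosure_three_fourteen : HasPairClosure 3 14 :=
  hasPairClosure_of_triples
    (cyclicOp 7 ![[0, 5, 3, 2, 6, 1, 4, 0, 10, 0, 8, 12, 11, 0],
      [7, 7, 13, 8, 12, 7, 9, 7, 3, 6, 7, 7, 4, 2]] 14) rfl (by decide)
    (by decide +kernel) (by decide +kernel) (by decide +kernel) (by decide +kernel)

theorem exists_solvesModel4_eight {j : ℕ} (hj : 4 ≤ j) (hj8 : j ≤ 8) :
    ∃ F : Finset (Finset (Fin 8)), SolvesModel4 F 1 j :=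
  ⟨{{0, 5, 6}, {0, 1, 2}, {3, 5, 7}, {2, 4, 6, 7}, {1, 3, 4}},
    solvesModel4_of_few _ hj hj8 (by decide +kernel) (by decide +kernel)⟩

/-! ### Induction on the size. -/

theorem hasPairClosure_two {n : ℕ} (hmod : n % 3 ≠ 2) (h6 : n ≠ 6) : HasPairClosure 2 n := by
  induction n using Nat.strong_induction_on with
  | _ n ih =>
    have step : ∀ t, t % 3 ≠ 2 → t ≠ 6 → t < n → (n - t) % 6 = 3 → ((n - t) / 3) % 3 ≠ 2 →
        4 * t ≤ n → HasPairClosure 2 n := by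
      intro t ht3 ht6 htn h1 h2 h3
      have h := HasPairClosure.three_mul_add (m := (n - t) / 3) (t := t) le_rfl
        (Nat.odd_iff.2 (by omega)) (by omega) (ih _ (by omega) h2 (by omega)) (ih t htn ht3 ht6)
      rwa [show 3 * ((n - t) / 3) + t = n by omega] at h
    have hcop : Odd n → 4 ≤ n → Nat.Coprime 5 n → HasPairClosure 2 n :=
      hasPairClosure_two_of_coprime
    -- For fixed t, the residue of m = (n - t) / 3 modulo 6 depends only on n modulo 18. Each t
    -- makes m odd and not 2 modulo 3; sizes below 4t need another construction.
    have hlt : n % 18 < 18 := Nat.mod_lt _ (by norm_num)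
    obtain h | h | h | h | h | h | h | h | h | h | h | h : n % 18 = 0 ∨ n % 18 = 1 ∨ n % 18 = 3 ∨
        n % 18 = 4 ∨ n % 18 = 6 ∨ n % 18 = 7 ∨ n % 18 = 9 ∨ n % 18 = 10 ∨ n % 18 = 12 ∨
        n % 18 = 13 ∨ n % 18 = 15 ∨ n % 18 = 16 := by omega
    · obtain rfl | rfl | hn : n = 0 ∨ n = 18 ∨ 36 ≤ n := by omega
      · exact hasPairClosure_zero 2
      · exact hasPairClosure_two_eighteen
      · exact step 9 (by omega) (by omega) (by omega) (by omega) (by omega) (by omega)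
    · obtain rfl | rfl | rfl | hn : n = 1 ∨ n = 19 ∨ n = 37 ∨ 40 ≤ n := by omega
      · exact hasPairClosure_one 2
      · exact hcop (by decide) (by omega) (by decide)
      · exact hcop (by decide) (by omega) (by decide)
      · exact step 10 (by omega) (by omega) (by omega) (by omega) (by omega) (by omega)
    · exact step 0 (by omega) (by omega) (by omega) (by omega) (by omega) (by omega)
    · exact step 1 (by omega) (by omega) (by omega) (by omega) (by omega) (by omega)
    · exact step 3 (by omega) (by omega) (by omega) (by omega) (by omega) (by omega)
    · obtain rfl | hn : n = 7 ∨ 25 ≤ n := by omega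
      · exact hcop (by decide) (by omega) (by decide)
      · exact step 4 (by omega) (by omega) (by omega) (by omega) (by omega) (by omega)
    · exact step 0 (by omega) (by omega) (by omega) (by omega) (by omega) (by omega)
    · exact step 1 (by omega) (by omega) (by omega) (by omega) (by omega) (by omega)
    · exact step 3 (by omega) (by omega) (by omega) (by omega) (by omega) (by omega)
    · obtain rfl | hn : n = 13 ∨ 31 ≤ n := by omega
      · exact hcop (by decide) (by omega) (by decide)
      · exact step 4 (by omega) (by omega) (by omega) (by omega) (by omega) (by omega)
    · obtain rfl | rfl | hn : n = 15 ∨ n = 33 ∨ 51 ≤ n := by omega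
      · exact hasPairClosure_two_fifteen
      · exact hcop (by decide) (by omega) (by decide)
      · exact step 12 (by omega) (by omega) (by omega) (by omega) (by omega) (by omega)
    · obtain rfl | hn : n = 16 ∨ 34 ≤ n := by omega
      · exact hasPairClosure_two_sixteen
      · exact step 7 (by omega) (by omega) (by omega) (by omega) (by omega) (by omega)

theorem hasPairClosure_three {n : ℕ} (h2 : n ≠ 2) (h6 : n ≠ 6) (h8 : n ≠ 8) :
    HasPairClosure 3 n := by
  by_cases hmod : n % 3 = 2
  · have hodd : ∀ m, m % 2 = 1 → HasPairClosure 3 m := by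
      intro m hm
      obtain rfl | rfl | hm4 : m = 1 ∨ m = 3 ∨ 4 ≤ m := by omega
      · exact hasPairClosure_one 3
      · exact (hasPairClosure_two (by omega) (by omega)).mono (by omega)
      · exact hasPairClosure_three_of_odd (Nat.odd_iff.2 hm) hm4
    obtain hn | rfl | hn : n % 2 = 1 ∨ n = 14 ∨ n % 6 = 2 ∧ 20 ≤ n := by omega
    · exact hodd n hn
    · exact hasPairClosure_three_fourteen
    -- Every odd size admits k = 3, so t = 5 with m odd needs no induction; n ≥ 20 ensures 5 ≤ m.
    · have h := HasPairClosure.three_mul_add (k := 3) (m := (n - 5) / 3) (t := 5) (by omega)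
        (Nat.odd_iff.2 (by omega)) (by omega) (hodd _ (by omega)) (hodd 5 (by omega))
      rwa [show 3 * ((n - 5) / 3) + 5 = n by omega] at h
  · exact (hasPairClosure_two hmod h6).mono (by omega)

end SmartElements

theorem mainTheorem8 :
    (∀ n j : ℕ, 4 ≤ j → j ≤ n → n ≠ 6 →
      ∃ F : Finset (Finset (Fin n)), SmartElements.SolvesModel4 F 1 j) ∧
    (∀ n : ℕ, 3 ≤ n → n ≠ 6 → ¬ n ≡ 2 [MOD 6] → ¬ n ≡ 5 [MOD 6] →
      ∃ F : Finset (Finset (Fin n)), SmartElements.SolvesModel4 F 1 3) := by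
  refine ⟨fun n j hj hjn h6 => ?_, fun n hn h6 h2 h5 => ?_⟩
  · by_cases h8 : n = 8
    · subst h8
      exact SmartElements.exists_solvesModel4_eight hj hjn
    · exact (SmartElements.hasPairClosure_three (by omega) h6 h8).exists_solvesModel4
        (by omega) hjn
  · simp only [Nat.ModEq] at h2 h5
    exact (SmartElements.hasPairClosure_two (by omega) h6).exists_solvesModel4 (by omega) hn
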